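/- Graphs are finite, simple and undirected. For a graph $G$ let $\alpha(G)$ be its independence number. The strong product $G_1\boxtimes G_2$ has vertex set $V(G_1)\times V(G_2)$, two distinct vertices being adjacent when in each of the two coordinates they are equal or adjacent; $G^{\boxtimes n}$ is the $n$-fold strong product of $G$ with itself, and $G_1+G_2$ is the disjoint union. The Shannon capacity is $\Theta(G)=\lim_{n\to\infty}\alpha(G^{\boxtimes n})^{1/n}$, and $G$ is called single-shot if $\alpha(G)=\Theta(G)$. The Lovász number is $$\vartheta(G)=\min_{\Psi,(\psi_v)}\ \max_{v\in V(G)}\frac{1}{\langle\Psi,\psi_v\rangle^2},$$ where $\Psi$ ranges over the unit vectors of $\mathbb{R}^{V(G)}$ and $(\psi_v)$ over the families of unit vectors of $\mathbb{R}^{V(G)}$ with $\psi_u\perp\psi_v$ whenever $u\ne v$ are non-adjacent (and $1/0=\infty$). **Theorem.** There exist single-shot graphs $G_1$ and $G_2$, both without isolated vertices, with $\alpha(G_2)=\vartheta(G_2)$, such that $$\Theta(G_1\boxtimes G_2)>\Theta(G_1)\,\Theta(G_2)\qquad\text{and}\qquad \Theta(G_1+G_2)>\Theta(G_1)+\Theta(G_2).$$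 Explicitly, the following pair has all these properties. * $G_1$ is the graph whose $220$ vertices are the $3$-element subsets of $\{1,\dots,12\}$, with $v\sim w$ if and only if $|v\cap w|=1$. * Let $H$ be the graph whose vertices are of two kinds: the $3$-element subsets of $\{1,\dots,12\}$, and the unordered pairs $\{w,w'\}$ of such subsets with $|w\cap w'|=1$. Two subsets $v,w$ are adjacent if and only if $|v\cap w|\in\{0,2\}$; a subset $v$ and a pair $\{w,w'\}$ are adjacent if and only if $v\ne w$ and $v\neq w'$; any two distinct pairs are adjacent. $G_2$ is obtained from $H$ by replacing each vertex of the first kind by $13$ copies and each vertex of the second kind by $95$ copies, where two copies are adjacent if and only if the vertices of $H$ that they come from are adjacent (so copies of the same vertex are non-adjacent). $G_2$ has $1131460$ vertices. For this pair, $\alpha(G_1)=\Theta(G_1)=12$, $\vartheta(G_1)=\tfrac{260}{11}$, $\alpha(G_2)=\Theta(G_2)=\vartheta(G_2)=121$, and $$\Theta(G_1\boxtimes G_2)\ \ge\ \alpha(G_1\boxtimes G_2)\ \ge\ 121\cdot\tfrac{260}{11}=2860\ >\ 12\cdot 121=\Theta(G_1)\,\Theta(G_2).$$ -/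

import Mathlib

open Filter Topology
open scoped ENNReal

namespace SimpleGraph

/-- The strong product `G₁ ⊠ G₂`. -/
def strongProduct {V W : Type*} (G₁ : SimpleGraph V) (G₂ : SimpleGraph W) :
    SimpleGraph (V × W) where
  Adj u v := (G₁.Adj u.1 v.1 ∧ G₂.Adj u.2 v.2) ∨ (G₁.Adj u.1 v.1 ∧ u.2 = v.2) ∨
    (u.1 = v.1 ∧ G₂.Adj u.2 v.2)
  symm := ⟨by
    rintro u v (⟨h, k⟩ | ⟨h, k⟩ | ⟨h, k⟩)
    · exact Or.inl ⟨h.symm, k.symm⟩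
    · exact Or.inr (Or.inl ⟨h.symm, k.symm⟩)
    · exact Or.inr (Or.inr ⟨h.symm, k.symm⟩)⟩
  loopless := ⟨by
    rintro u (⟨h, -⟩ | ⟨h, -⟩ | ⟨-, h⟩)
    · exact G₁.irrefl h
    · exact G₁.irrefl h
    · exact G₂.irrefl h⟩

/-- The `n`-fold strong power of `G`: two distinct words of length `n` are adjacent
if at every position their letters are equal or adjacent. -/
def strongPower {V : Type*} (G : SimpleGraph V) (n : ℕ) : SimpleGraph (Fin n → V) where
  Adj x y := x ≠ y ∧ ∀ i, x i = y i ∨ G.Adj (x i) (y i)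
  symm := ⟨fun _ _ h => ⟨h.1.symm, fun i => (h.2 i).imp Eq.symm fun k => k.symm⟩⟩
  loopless := ⟨fun _ h => h.1 rfl⟩

/-- Each strong power arises from the previous one by a strong product with `G`. -/
def strongPowerSuccIso {V : Type*} (G : SimpleGraph V) (n : ℕ) :
    G.strongPower (n + 1) ≃g G.strongProduct (G.strongPower n) where
  toEquiv := (Fin.consEquiv fun _ => V).symm
  map_rel_iff' := by
    intro x y
    have hxy : x = y ↔ x 0 = y 0 ∧ Fin.tail x = Fin.tail y := by
      constructor
      · rintro rfl; exact ⟨rfl, rfl⟩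
      · rintro ⟨h, k⟩
        rw [← Fin.cons_self_tail x, ← Fin.cons_self_tail y, h, k]
    have hirr : x 0 = y 0 → ¬ G.Adj (x 0) (y 0) := fun h => by rw [h]; exact G.irrefl
    have htl : Fin.tail x = Fin.tail y → ∀ i : Fin n, x i.succ = y i.succ :=
      fun h i => congrFun h i
    simp only [strongProduct, strongPower, Fin.consEquiv, Equiv.coe_fn_symm_mk, Fin.forall_fin_succ,
      ne_eq, hxy]
    simp only [Fin.tail] at *
    grind

/-- The Shannon capacity `Θ(G) = lim α(G^{⊠ n})^{1/n}`. That the limit exists for every finite graph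
is `tendsto_shannonCapacity` below. -/
noncomputable def shannonCapacity {V : Type*} (G : SimpleGraph V) : ℝ :=
  limUnder atTop fun n : ℕ => ((G.strongPower n).indepNum : ℝ) ^ (1 / (n : ℝ))

theorem indepNum_strongPower_mul_le {V : Type*} [Finite V] (G : SimpleGraph V) (m n : ℕ) :
    (G.strongPower m).indepNum * (G.strongPower n).indepNum ≤
      (G.strongPower (m + n)).indepNum := by
  obtain ⟨s, hs⟩ := (G.strongPower m).exists_isNIndepSet_indepNum
  obtain ⟨t, ht⟩ := (G.strongPower n).exists_isNIndepSet_indepNum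
  let f : (Fin m → V) × (Fin n → V) ↪ (Fin (m + n) → V) := (Fin.appendEquiv m n).toEmbedding
  have hf : ∀ p, f p = Fin.append p.1 p.2 := fun _ => rfl
  rw [← hs.card_eq, ← ht.card_eq, ← Finset.card_product, ← Finset.card_map f]
  apply IsIndepSet.card_le_indepNum
  intro x hx y hy hxy hadj
  obtain ⟨p, hp, rfl⟩ := Finset.mem_map.1 (Finset.mem_coe.1 hx)
  obtain ⟨q, hq, rfl⟩ := Finset.mem_map.1 (Finset.mem_coe.1 hy)
  rw [Finset.mem_product] at hp hq
  have h := hadj.2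
  rw [hf, hf] at h
  have h1 : ∀ i, p.1 i = q.1 i ∨ G.Adj (p.1 i) (q.1 i) := fun i => by
    simpa using h (Fin.castAdd n i)
  have h2 : ∀ i, p.2 i = q.2 i ∨ G.Adj (p.2 i) (q.2 i) := fun i => by
    simpa using h (Fin.natAdd m i)
  by_cases e1 : p.1 = q.1
  · by_cases e2 : p.2 = q.2
    · exact hxy (congrArg f (Prod.ext e1 e2))
    · exact ht.isIndepSet hp.2 hq.2 e2 ⟨e2, h2⟩
  · exact hs.isIndepSet hp.1 hq.1 e1 ⟨e1, h1⟩

theorem tendsto_shannonCapacity {V : Type*} [Finite V] (G : SimpleGraph V) :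
    Tendsto (fun n : ℕ => ((G.strongPower n).indepNum : ℝ) ^ (1 / (n : ℝ))) atTop
      (𝓝 G.shannonCapacity) := by
  apply tendsto_nhds_limUnder
  have := Fintype.ofFinite V
  set a : ℕ → ℕ := fun n => (G.strongPower n).indepNum with ha
  rcases isEmpty_or_nonempty V with hV | hV
  · refine ⟨0, tendsto_const_nhds.congr' ?_⟩
    filter_upwards [eventually_ge_atTop 1] with n hn
    obtain ⟨s, hs⟩ := (G.strongPower n).exists_isNIndepSet_indepNum
    have : IsEmpty (Fin n → V) := ⟨fun x => hV.elim (x ⟨0, hn⟩)⟩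
    have h0 : (G.strongPower n).indepNum = 0 := by
      rw [← hs.card_eq, Finset.eq_empty_of_isEmpty s, Finset.card_empty]
    have hn' : (1 / (n : ℝ)) ≠ 0 := by positivity
    simp only [h0, Nat.cast_zero, Real.zero_rpow hn']
  · have hpos : ∀ n, 0 < a n := fun n => by
      obtain ⟨v⟩ := hV
      have : (G.strongPower n).IsIndepSet (({fun _ => v} : Finset (Fin n → V)) : Set _) := by simp
      have h1 := this.card_le_indepNum
      rw [Finset.card_singleton] at h1
      exact h1
    have hle : ∀ n, a n ≤ Fintype.card V ^ n := fun n => by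
      obtain ⟨s, hs⟩ := (G.strongPower n).exists_isNIndepSet_indepNum
      have h := Finset.card_le_univ s
      rw [hs.card_eq] at h
      simpa using h
    have hposR : ∀ n, (0 : ℝ) < a n := fun n => by exact_mod_cast hpos n
    have hsub : Subadditive fun n => -Real.log (a n) := by
      intro m n
      have h : ((a m : ℝ)) * a n ≤ a (m + n) := by
        exact_mod_cast G.indepNum_strongPower_mul_le m n
      have h' := Real.log_le_log (mul_pos (hposR m) (hposR n)) h
      rw [Real.log_mul (hposR m).ne' (hposR n).ne'] at h'
      simp only
      linarith
    have hbdd : BddBelow (Set.range fun n : ℕ => -Real.log (a n) / n) := by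
      refine ⟨-Real.log (Fintype.card V), ?_⟩
      rintro _ ⟨n, rfl⟩
      have hc : (1 : ℝ) ≤ Fintype.card V := by exact_mod_cast Fintype.card_pos
      rcases Nat.eq_zero_or_pos n with rfl | hn
      · simpa using Real.log_nonneg hc
      · have hn' : (0 : ℝ) < n := by exact_mod_cast hn
        have h : Real.log (a n) ≤ n * Real.log (Fintype.card V) := by
          rw [← Real.log_pow]
          exact Real.log_le_log (hposR n) (by exact_mod_cast hle n)
        simp only
        rw [le_div_iff₀ hn']
        linarith
    refine ⟨Real.exp (-hsub.lim), ?_⟩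
    have h := (Real.continuous_exp.tendsto _).comp (hsub.tendsto_lim hbdd).neg
    refine h.congr fun n => ?_
    rw [Function.comp_apply, Real.rpow_def_of_pos (hposR n)]
    congr 1
    ring

/-- `G` is single-shot if `α(G) = Θ(G)`. -/
def IsSingleShot {V : Type*} (G : SimpleGraph V) : Prop :=
  (G.indepNum : ℝ) = G.shannonCapacity

/-- An orthonormal labeling assigns unit vectors to the vertices such that distinct non-adjacent
vertices are sent to orthogonal vectors. -/
def IsOrthonormalLabeling {V : Type*} [Fintype V] (G : SimpleGraph V)
    (ψ : V → EuclideanSpace ℝ V) : Prop :=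
  (∀ v, ‖ψ v‖ = 1) ∧ ∀ u v, u ≠ v → ¬ G.Adj u v → inner ℝ (ψ u) (ψ v) = 0

/-- The Lovász number `ϑ(G) = min_{Ψ, ψ} max_v 1 / ⟨Ψ, ψ_v⟩²`, where `Ψ` is a unit vector and `ψ` an
orthonormal labeling of `G`. It is valued in `[0, ∞]`, where `1 / 0 = ∞`. -/
noncomputable def lovaszNumber {V : Type*} [Fintype V] (G : SimpleGraph V) : ℝ≥0∞ :=
  ⨅ (Ψ : EuclideanSpace ℝ V) (ψ : V → EuclideanSpace ℝ V)
    (_ : ‖Ψ‖ = 1) (_ : G.IsOrthonormalLabeling ψ),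
    ⨆ v, (ENNReal.ofReal (inner ℝ Ψ (ψ v) ^ 2))⁻¹

/-- The blow-up of `G` along `p`: every vertex `v` is replaced by `p v` pairwise
non-adjacent copies. -/
def blowUp {V : Type*} (G : SimpleGraph V) (p : V → ℕ) : SimpleGraph (Σ v, Fin (p v)) where
  Adj x y := G.Adj x.1 y.1
  symm := ⟨fun _ _ h => h.symm⟩
  loopless := ⟨fun x h => G.irrefl (v := x.1) h⟩

end SimpleGraph

/-- The `3`-element subsets of a `12`-element set. -/
abbrev Triple : Type := {s : Finset (Fin 12) // s.card = 3}

/-- The graph on the `3`-element subsets of a `12`-element set, two of them being adjacent when they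
have exactly one element in common. -/
def tripleGraph : SimpleGraph Triple where
  Adj v w := (v.1 ∩ w.1).card = 1
  symm := ⟨fun v w h => by rw [Finset.inter_comm]; exact h⟩
  loopless := ⟨fun v h => by rw [Finset.inter_self, v.2] at h; omega⟩

instance : DecidableRel tripleGraph.Adj :=
  fun v w => inferInstanceAs (Decidable ((v.1 ∩ w.1).card = 1))

/-- The graph whose vertices are the triples (first kind) and the unordered pairs of triples with
exactly one element in common, i.e. the edges of `tripleGraph` (second kind). Triples `v, w` are
adjacent when `|v ∩ w| ∈ {0, 2}`; a triple `v` is adjacent to a pair `e` when `v ∉ e`; any two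
distinct pairs are adjacent. -/
def triplePairGraph : SimpleGraph (Triple ⊕ tripleGraph.edgeSet) where
  Adj
    | .inl v, .inl w => (v.1 ∩ w.1).card = 0 ∨ (v.1 ∩ w.1).card = 2
    | .inl v, .inr e => v ∉ e.1
    | .inr e, .inl v => v ∉ e.1
    | .inr e, .inr f => e ≠ f
  symm := ⟨by
    rintro (v | e) (w | f) h
    · simpa only [Finset.inter_comm] using h
    · exact h
    · exact h
    · exact Ne.symm h⟩
  loopless := ⟨by
    rintro (v | e) h
    · simp [v.2] at h
    · exact h rfl⟩

/-- The multiplicities: `13` for every triple, `95` for every pair of triples. -/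
def triplePairWeight : Triple ⊕ tripleGraph.edgeSet → ℕ :=
  Sum.elim (fun _ => 13) (fun _ => 95)

/-- The blow-up of `triplePairGraph` by `13` copies of each triple and `95` copies of each pair. -/
def triplePairBlowUp : SimpleGraph (Σ v, Fin (triplePairWeight v)) :=
  triplePairGraph.blowUp triplePairWeight

/-! The gap comes from bounding the two capacities by different methods. Over the field with two
elements the indicator vectors of triples form an orthogonal representation of `tripleGraph` in
dimension 12, so Haemers' bound gives capacity at most 12, although its Lovász number is 260/11. The
other graph is made for the Lovász bound: its triples carry the complementary adjacency, and the
multiplicities 13 and 95 are 121 times the squared inner products of the handle with an orthogonal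
representation, so 121 bounds the Lovász number of the blow-up. The triples alone could not attain
this bound, since a maximal independent set of their blow-up has size divisible by 13; an extra
vertex for each edge of `tripleGraph` repairs this through 13 + 13 + 95 = 121.

Complementary adjacencies make the diagonal of the strong product independent, with 220 · 13 = 2860
points, well above 12 · 121. Since Lovász representations multiply, 2860 ≤ t · 121 for every value t
attained on `tripleGraph`, which also proves that 260/11 is optimal there. For the disjoint union,
the square of `G + H` contains two copies of the product, so the same diagonal enlarges the cross
term of (12 + 121)².

The explicit representations are matrices whose entries depend only on intersection sizes; their
identities reduce to one evaluation for each intersection size 0, 1, 2, 3. -/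

namespace SimpleGraph

/-! ### Shannon capacity: bounds through powers, and the square of a disjoint union. -/

section Capacity

variable {V W : Type*}

theorem card_le_indepNum_of_embedding [Fintype V] [Finite W] {H : SimpleGraph W}
    (f : V ↪ W) (hf : ∀ u v, ¬ H.Adj (f u) (f v)) : Fintype.card V ≤ H.indepNum := by
  rw [← Finset.card_univ, ← Finset.card_map f]
  apply IsIndepSet.card_le_indepNum
  intro x hx y hy _
  obtain ⟨u, -, rfl⟩ := Finset.mem_map.1 (Finset.mem_coe.1 hx)
  obtain ⟨v, -, rfl⟩ := Finset.mem_map.1 (Finset.mem_coe.1 hy)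
  exact hf u v

theorem indepNum_le_indepNum_strongPower_one [Finite V] (G : SimpleGraph V) :
    G.indepNum ≤ (G.strongPower 1).indepNum := by
  obtain ⟨s, hs⟩ := G.exists_isNIndepSet_indepNum
  rw [← hs.card_eq, ← Fintype.card_coe]
  refine card_le_indepNum_of_embedding
    ⟨fun v _ => (v : V), fun _ _ h => Subtype.ext (congrFun h 0)⟩ fun u v h => ?_
  rcases h.2 0 with e | e
  · exact h.1 (funext fun _ => e)
  · exact hs.isIndepSet u.2 v.2 e.ne e

theorem one_le_indepNum_strongPower_zero [Finite V] (G : SimpleGraph V) :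
    1 ≤ (G.strongPower 0).indepNum := by
  have : (G.strongPower 0).IsIndepSet (({Fin.elim0} : Finset (Fin 0 → V)) : Set _) := by simp
  simpa using this.card_le_indepNum

theorem indepNum_strongPower_pow_le [Finite V] (G : SimpleGraph V) (m k : ℕ) :
    (G.strongPower m).indepNum ^ k ≤ (G.strongPower (m * k)).indepNum := by
  induction k with
  | zero => simpa using G.one_le_indepNum_strongPower_zero
  | succ k ih =>
    rw [pow_succ, Nat.mul_succ]
    exact (Nat.mul_le_mul_right _ ih).trans (G.indepNum_strongPower_mul_le _ _)

/-- By supermultiplicativity the normalized roots along the multiples of `m` never fall below the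
root at `m`, and they converge to the capacity. -/
theorem indepNum_strongPower_le_pow [Finite V] (G : SimpleGraph V) {m : ℕ} (hm : m ≠ 0) :
    ((G.strongPower m).indepNum : ℝ) ≤ G.shannonCapacity ^ m := by
  have hm0 : (0 : ℝ) < m := by exact_mod_cast Nat.pos_of_ne_zero hm
  have htend : Tendsto (fun k : ℕ => m * k) atTop atTop :=
    tendsto_id.const_mul_atTop' (Nat.pos_of_ne_zero hm)
  have h1 := G.tendsto_shannonCapacity.comp htend
  have h2 : ((G.strongPower m).indepNum : ℝ) ^ (1 / (m : ℝ)) ≤ G.shannonCapacity := by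
    refine ge_of_tendsto h1 ?_
    filter_upwards [eventually_ge_atTop 1] with k hk
    have hk0 : (0 : ℝ) < k := by exact_mod_cast hk
    have h : ((G.strongPower m).indepNum : ℝ) ^ k ≤ (G.strongPower (m * k)).indepNum := by
      exact_mod_cast G.indepNum_strongPower_pow_le m k
    have e : ((G.strongPower m).indepNum : ℝ) ^ (1 / (m : ℝ)) =
        (((G.strongPower m).indepNum : ℝ) ^ k) ^ (1 / ((m * k : ℕ) : ℝ)) := by
      rw [← Real.rpow_natCast, ← Real.rpow_mul (Nat.cast_nonneg _)]
      congr 1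
      push_cast
      field_simp
    rw [e]
    exact Real.rpow_le_rpow (by positivity) h (by positivity)
  calc ((G.strongPower m).indepNum : ℝ)
      = (((G.strongPower m).indepNum : ℝ) ^ (1 / (m : ℝ))) ^ m := by
        rw [one_div, Real.rpow_inv_natCast_pow (Nat.cast_nonneg _) hm]
    _ ≤ _ := pow_le_pow_left₀ (by positivity) h2 m

theorem indepNum_le_shannonCapacity [Finite V] (G : SimpleGraph V) :
    (G.indepNum : ℝ) ≤ G.shannonCapacity := by
  have h := G.indepNum_strongPower_le_pow one_ne_zero
  rw [pow_one] at h
  exact le_trans (by exact_mod_cast G.indepNum_le_indepNum_strongPower_one) h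

theorem shannonCapacity_nonneg [Finite V] (G : SimpleGraph V) : 0 ≤ G.shannonCapacity :=
  (Nat.cast_nonneg _).trans G.indepNum_le_shannonCapacity

theorem shannonCapacity_le_of_pow [Finite V] (G : SimpleGraph V) {c : ℝ} (hc : 0 ≤ c)
    (h : ∀ n, ((G.strongPower n).indepNum : ℝ) ≤ c ^ n) : G.shannonCapacity ≤ c := by
  refine le_of_tendsto G.tendsto_shannonCapacity ?_
  filter_upwards [eventually_ge_atTop 1] with n hn
  calc ((G.strongPower n).indepNum : ℝ) ^ (1 / (n : ℝ))
      ≤ (c ^ n) ^ (1 / (n : ℝ)) := Real.rpow_le_rpow (by positivity) (h n) (by positivity)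
    _ = c := by rw [one_div, Real.pow_rpow_inv_natCast hc (by omega)]

/-- The words of length two over `G + H` split into four parts with no edges between them. -/
theorem indepNum_sum_strongPower_two [Finite V] [Finite W] (G : SimpleGraph V)
    (H : SimpleGraph W) :
    G.indepNum ^ 2 + 2 * (G.strongProduct H).indepNum + H.indepNum ^ 2 ≤
      ((G ⊕g H).strongPower 2).indepNum := by
  obtain ⟨s, hs⟩ := G.exists_isNIndepSet_indepNum
  obtain ⟨t, ht⟩ := H.exists_isNIndepSet_indepNum
  obtain ⟨p, hp⟩ := (G.strongProduct H).exists_isNIndepSet_indepNum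
  have key : ∀ {r : Finset (((V × V) ⊕ (V × W)) ⊕ ((V × W) ⊕ (W × W)))},
      r = ((s ×ˢ s).disjSum p).disjSum (p.disjSum (t ×ˢ t)) →
      r.card ≤ ((G ⊕g H).strongPower 2).indepNum := by
    rintro r rfl
    -- The parts are the words of types GG, GH, HG and HH. The set `p` serves both mixed types, with
    -- the letters swapped for HG.
    let f : (((V × V) ⊕ (V × W)) ⊕ ((V × W) ⊕ (W × W))) → (Fin 2 → V ⊕ W) :=
      Sum.elim (Sum.elim (fun x => ![.inl x.1, .inl x.2]) (fun x => ![.inl x.1, .inr x.2]))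
        (Sum.elim (fun x => ![.inr x.2, .inl x.1]) (fun x => ![.inr x.1, .inr x.2]))
    have hf : Function.Injective f := by
      rintro ((⟨a, b⟩ | ⟨a, b⟩) | (⟨a, b⟩ | ⟨a, b⟩)) ((⟨c, d⟩ | ⟨c, d⟩) | (⟨c, d⟩ | ⟨c, d⟩)) h <;>
      · have h0 := congrFun h 0
        have h1 := congrFun h 1
        simp [f] at h0 h1 ⊢
        try exact ⟨‹_›, ‹_›⟩
    rw [← Finset.card_map ⟨f, hf⟩]
    apply IsIndepSet.card_le_indepNum
    intro x hx y hy hxy hadj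
    obtain ⟨u, hu, rfl⟩ := Finset.mem_map.1 (Finset.mem_coe.1 hx)
    obtain ⟨v, hv, rfl⟩ := Finset.mem_map.1 (Finset.mem_coe.1 hy)
    have huv : u ≠ v := fun h => hxy (congrArg f h)
    have hs' : ∀ a ∈ s, ∀ b ∈ s, ¬ G.Adj a b := fun a ha b hb h =>
      hs.isIndepSet ha hb h.ne h
    have ht' : ∀ a ∈ t, ∀ b ∈ t, ¬ H.Adj a b := fun a ha b hb h =>
      ht.isIndepSet ha hb h.ne h
    have hp' : ∀ a ∈ p, ∀ b ∈ p, ¬ (G.strongProduct H).Adj a b := fun a ha b hb h =>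
      hp.isIndepSet ha hb h.ne h
    have h0 := hadj.2 0
    have h1 := hadj.2 1
    rcases u with ((⟨a, b⟩ | ⟨a, b⟩) | (⟨a, b⟩ | ⟨a, b⟩)) <;>
      rcases v with ((⟨c, d⟩ | ⟨c, d⟩) | (⟨c, d⟩ | ⟨c, d⟩)) <;>
      simp [f, strongProduct] at h0 h1 hu hv huv hp' <;> grind
  have := key rfl
  simp only [Finset.card_disjSum, Finset.card_product, hs.card_eq, ht.card_eq, hp.card_eq] at this
  nlinarith

end Capacity

/-! ### Orthogonal representations, Haemers' bound and Lovász's bound. -/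

section OrthogonalRepresentation

variable {V W ι κ K : Type*} [Fintype ι] [Fintype κ] [Field K]

/-- Vectors of square one, orthogonal at distinct non-adjacent vertices. -/
def IsOrthogonalRep (G : SimpleGraph V) (f : V → ι → K) : Prop :=
  (∀ v, f v ⬝ᵥ f v = 1) ∧ ∀ u v, u ≠ v → ¬ G.Adj u v → f u ⬝ᵥ f v = 0

theorem dotProduct_tensor (a c : ι → K) (b d : κ → K) :
    (fun x : ι × κ => a x.1 * b x.2) ⬝ᵥ (fun x => c x.1 * d x.2) = (a ⬝ᵥ c) * (b ⬝ᵥ d) := by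
  simp only [dotProduct, Fintype.sum_prod_type, Finset.sum_mul_sum]
  exact Finset.sum_congr rfl fun i _ => Finset.sum_congr rfl fun j _ => by ring

theorem dotProduct_tensorPower [DecidableEq ι] {n : ℕ} (a b : Fin n → ι → K) :
    (fun x : Fin n → ι => ∏ i, a i (x i)) ⬝ᵥ (fun x => ∏ i, b i (x i)) =
      ∏ i, (a i ⬝ᵥ b i) := by
  simp only [dotProduct, Finset.prod_univ_sum, Fintype.piFinset_univ, Finset.prod_mul_distrib]

theorem IsOrthogonalRep.strongProduct {G : SimpleGraph V} {H : SimpleGraph W} {f : V → ι → K}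
    {g : W → κ → K} (hf : G.IsOrthogonalRep f) (hg : H.IsOrthogonalRep g) :
    (G.strongProduct H).IsOrthogonalRep fun v (x : ι × κ) => f v.1 x.1 * g v.2 x.2 := by
  refine ⟨fun v => by rw [dotProduct_tensor, hf.1, hg.1, one_mul], ?_⟩
  rintro ⟨a, b⟩ ⟨c, d⟩ hne hadj
  rw [dotProduct_tensor]
  simp only [SimpleGraph.strongProduct, ne_eq, Prod.mk.injEq] at hne hadj ⊢
  by_cases h : a ≠ c ∧ ¬ G.Adj a c
  · rw [hf.2 a c h.1 h.2, zero_mul]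
  · rw [hg.2 b d (by tauto) (by tauto), mul_zero]

theorem IsOrthogonalRep.strongPower [DecidableEq ι] {G : SimpleGraph V} {f : V → ι → K}
    (hf : G.IsOrthogonalRep f) (n : ℕ) :
    (G.strongPower n).IsOrthogonalRep fun v (x : Fin n → ι) => ∏ i, f (v i) (x i) := by
  refine ⟨fun v => ?_, fun u v hne hadj => ?_⟩
  · rw [dotProduct_tensorPower fun i => f (v i)]
    simp [hf.1]
  · rw [dotProduct_tensorPower (fun i => f (u i)) fun i => f (v i)]
    have : ∃ i, ¬ (u i = v i ∨ G.Adj (u i) (v i)) := by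
      by_contra! h
      exact hadj ⟨hne, h⟩
    obtain ⟨i, hi⟩ := this
    push Not at hi
    exact Finset.prod_eq_zero (Finset.mem_univ i) (hf.2 _ _ hi.1 hi.2)

/-- Haemers' bound for the independence number. -/
theorem IsOrthogonalRep.indepNum_le_card [Finite V] {G : SimpleGraph V} {f : V → ι → K}
    (hf : G.IsOrthogonalRep f) : G.indepNum ≤ Fintype.card ι := by
  classical
  obtain ⟨s, hs⟩ := G.exists_isNIndepSet_indepNum
  -- Pairing a linear relation with `f v` leaves only the coefficient of `v`. No positivity enters,
  -- so any field will do.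
  have hli : LinearIndependent K fun v : s => f v := by
    rw [Fintype.linearIndependent_iff]
    intro g hg v
    have h := congrArg (fun x => x ⬝ᵥ f v) hg
    simp only [zero_dotProduct, sum_dotProduct, smul_dotProduct, smul_eq_mul] at h
    rw [Finset.sum_eq_single v] at h
    · simpa [hf.1] using h
    · intro w _ hw
      have hne : (w : V) ≠ v := fun e => hw (Subtype.ext e)
      rw [hf.2 _ _ hne (hs.isIndepSet w.2 v.2 hne), mul_zero]
    · simp
  have h := hli.fintype_card_le_finrank
  simpa [hs.card_eq] using h

/-- Haemers' bound for the Shannon capacity. -/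
theorem IsOrthogonalRep.shannonCapacity_le_card [Finite V] {G : SimpleGraph V} {f : V → ι → K}
    (hf : G.IsOrthogonalRep f) : G.shannonCapacity ≤ Fintype.card ι := by
  classical
  refine G.shannonCapacity_le_of_pow (Nat.cast_nonneg _) fun n => ?_
  have h := (hf.strongPower n).indepNum_le_card
  simp only [Fintype.card_fun, Fintype.card_fin] at h
  exact_mod_cast h

/-- Bessel's inequality in coordinates. -/
theorem sum_dotProduct_sq_le_one {s : Finset V} {f : V → ι → ℝ} {c : ι → ℝ} (hc : c ⬝ᵥ c = 1)
    (h1 : ∀ v ∈ s, f v ⬝ᵥ f v = 1) (h0 : ∀ u ∈ s, ∀ v ∈ s, u ≠ v → f u ⬝ᵥ f v = 0) :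
    ∑ v ∈ s, (c ⬝ᵥ f v) ^ 2 ≤ 1 := by
  classical
  have hon : Orthonormal ℝ fun v : s => WithLp.toLp 2 (f v) := by
    rw [orthonormal_iff_ite]
    intro u v
    rw [EuclideanSpace.inner_toLp_toLp, star_trivial]
    split_ifs with h
    · rw [h, h1 v v.2]
    · exact h0 v v.2 u u.2 fun e => h (Subtype.ext e.symm)
  have hb := hon.sum_inner_products_le (WithLp.toLp 2 c) (s := Finset.univ)
  have hn : ‖WithLp.toLp 2 c‖ ^ 2 = 1 := by
    rw [← real_inner_self_eq_norm_sq, EuclideanSpace.inner_toLp_toLp, star_trivial, hc]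
  rw [hn] at hb
  simp only [EuclideanSpace.inner_toLp_toLp, star_trivial, Real.norm_eq_abs, sq_abs] at hb
  rwa [Finset.sum_coe_sort s fun v => (c ⬝ᵥ f v) ^ 2] at hb

/-- The orthogonal representation `f` with the unit handle `c` witnesses that the Lovász number is
at most `t`. -/
structure IsLovaszRep (G : SimpleGraph V) (c : ι → ℝ) (f : V → ι → ℝ) (t : ℝ) : Prop where
  rep : G.IsOrthogonalRep f
  handle : c ⬝ᵥ c = 1
  le_mul : ∀ v, 1 ≤ t * (c ⬝ᵥ f v) ^ 2

theorem IsLovaszRep.pos [Nonempty V] {G : SimpleGraph V} {c : ι → ℝ} {f : V → ι → ℝ} {t : ℝ}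
    (h : G.IsLovaszRep c f t) : 0 < t := by
  obtain ⟨v⟩ := ‹Nonempty V›
  by_contra ht
  nlinarith [h.le_mul v, mul_nonneg (neg_nonneg.2 (not_lt.1 ht)) (sq_nonneg (c ⬝ᵥ f v))]

/-- An independent set is sent to an orthonormal family; each of its members contributes at least
1/t to a Bessel sum bounded by 1. -/
theorem IsLovaszRep.indepNum_le [Finite V] [Nonempty V] {G : SimpleGraph V} {c : ι → ℝ}
    {f : V → ι → ℝ} {t : ℝ} (h : G.IsLovaszRep c f t) : (G.indepNum : ℝ) ≤ t := by
  obtain ⟨s, hs⟩ := G.exists_isNIndepSet_indepNum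
  have hsum := sum_dotProduct_sq_le_one (s := s) h.handle (fun v _ => h.rep.1 v)
    fun u hu v hv huv => h.rep.2 u v huv (hs.isIndepSet hu hv huv)
  calc (G.indepNum : ℝ) = ∑ v ∈ s, (1 : ℝ) := by simp [hs.card_eq]
    _ ≤ ∑ v ∈ s, t * (c ⬝ᵥ f v) ^ 2 := Finset.sum_le_sum fun v _ => h.le_mul v
    _ = t * ∑ v ∈ s, (c ⬝ᵥ f v) ^ 2 := by rw [Finset.mul_sum]
    _ ≤ t * 1 := mul_le_mul_of_nonneg_left hsum h.pos.le
    _ = t := mul_one t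

/-- Inner products of tensors multiply, and a non-adjacent pair of distinct vertices has a
coordinate that is distinct and non-adjacent. -/
theorem IsLovaszRep.strongProduct {G : SimpleGraph V} {H : SimpleGraph W} {c : ι → ℝ}
    {f : V → ι → ℝ} {d : κ → ℝ} {g : W → κ → ℝ} {s t : ℝ} (hf : G.IsLovaszRep c f s)
    (hg : H.IsLovaszRep d g t) :
    (G.strongProduct H).IsLovaszRep (fun x : ι × κ => c x.1 * d x.2)
      (fun v x => f v.1 x.1 * g v.2 x.2) (s * t) where
  rep := hf.rep.strongProduct hg.rep
  handle := by rw [dotProduct_tensor, hf.handle, hg.handle, one_mul]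
  le_mul v := by
    rw [dotProduct_tensor]
    calc (1 : ℝ) = 1 * 1 := by ring
      _ ≤ (s * (c ⬝ᵥ f v.1) ^ 2) * (t * (d ⬝ᵥ g v.2) ^ 2) :=
        mul_le_mul (hf.le_mul _) (hg.le_mul _) zero_le_one (zero_le_one.trans (hf.le_mul _))
      _ = _ := by ring

theorem IsLovaszRep.strongPower [DecidableEq ι] {G : SimpleGraph V} {c : ι → ℝ}
    {f : V → ι → ℝ} {t : ℝ} (h : G.IsLovaszRep c f t) (n : ℕ) :
    (G.strongPower n).IsLovaszRep (fun x : Fin n → ι => ∏ i, c (x i))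
      (fun v x => ∏ i, f (v i) (x i)) (t ^ n) where
  rep := h.rep.strongPower n
  handle := by
    rw [dotProduct_tensorPower fun _ => c]
    simp [h.handle]
  le_mul v := by
    rw [dotProduct_tensorPower (fun _ => c) fun i => f (v i), ← Finset.prod_pow]
    have : t ^ n = ∏ _i : Fin n, t := by simp
    rw [this, ← Finset.prod_mul_distrib]
    exact Finset.prod_induction _ (1 ≤ ·) (fun _ _ => one_le_mul_of_one_le_of_one_le) le_rfl
      fun i _ => h.le_mul (v i)

theorem IsLovaszRep.shannonCapacity_le [Finite V] [Nonempty V] {G : SimpleGraph V} {c : ι → ℝ}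
    {f : V → ι → ℝ} {t : ℝ} (h : G.IsLovaszRep c f t) : G.shannonCapacity ≤ t := by
  classical
  exact G.shannonCapacity_le_of_pow h.pos.le fun n => (h.strongPower n).indepNum_le

end OrthogonalRepresentation

/-! ### Comparison of the Lovász number with representations in arbitrary dimension. -/

section LovaszNumber

variable {V : Type*} [Fintype V]

theorem le_lovaszNumber (G : SimpleGraph V) {r : ℝ}
    (h : ∀ (c : V → ℝ) (f : V → V → ℝ) (t : ℝ), G.IsLovaszRep c f t → r ≤ t) :
    ENNReal.ofReal r ≤ G.lovaszNumber := by
  refine le_iInf fun Ψ => le_iInf fun ψ => le_iInf fun hΨ => le_iInf fun hψ => ?_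
  set s := ⨆ v, (ENNReal.ofReal (inner ℝ Ψ (ψ v) ^ 2))⁻¹ with hs
  -- A finite supremum forces every inner product with the handle to be nonzero, so the reciprocals
  -- can be cleared.
  rcases eq_or_ne s ⊤ with htop | htop
  · rw [htop]; exact le_top
  refine ENNReal.ofReal_le_of_le_toReal (h Ψ.ofLp (fun v => (ψ v).ofLp) s.toReal ⟨⟨?_, ?_⟩, ?_, ?_⟩)
  · intro v
    have := real_inner_self_eq_norm_sq (ψ v)
    rw [hψ.1 v, EuclideanSpace.inner_eq_star_dotProduct, star_trivial] at this
    simpa using this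
  · intro u v huv hadj
    have := hψ.2 v u huv.symm fun h => hadj h.symm
    rwa [EuclideanSpace.inner_eq_star_dotProduct, star_trivial] at this
  · have := real_inner_self_eq_norm_sq Ψ
    rw [hΨ, EuclideanSpace.inner_eq_star_dotProduct, star_trivial] at this
    simpa using this
  · intro v
    have hv : (ENNReal.ofReal (inner ℝ Ψ (ψ v) ^ 2))⁻¹ ≤ s :=
      le_iSup (fun v => (ENNReal.ofReal (inner ℝ Ψ (ψ v) ^ 2))⁻¹) v
    have e : inner ℝ Ψ (ψ v) = Ψ.ofLp ⬝ᵥ (ψ v).ofLp := by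
      rw [EuclideanSpace.inner_eq_star_dotProduct, star_trivial, dotProduct_comm]
    rw [← e]
    set q := inner ℝ Ψ (ψ v) ^ 2
    have hq : 0 < q := by
      by_contra hq
      rw [ENNReal.ofReal_of_nonpos (not_lt.1 hq), ENNReal.inv_zero, top_le_iff] at hv
      exact htop hv
    have h2 := ENNReal.toReal_mono htop hv
    rw [ENNReal.toReal_inv, ENNReal.toReal_ofReal hq.le] at h2
    calc (1 : ℝ) = q⁻¹ * q := (inv_mul_cancel₀ hq.ne').symm
      _ ≤ s.toReal * q := mul_le_mul_of_nonneg_right h2 hq.le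

/-- Labelings in any inner product space bound the Lovász number. -/
theorem lovaszNumber_le_of_inner [Nonempty V] {E : Type*} [NormedAddCommGroup E]
    [InnerProductSpace ℝ E] (G : SimpleGraph V) (c : E) (f : V → E) {t : ℝ} (hc : ‖c‖ = 1)
    (h1 : ∀ v, ‖f v‖ = 1) (h0 : ∀ u v, u ≠ v → ¬ G.Adj u v → inner ℝ (f u) (f v) = 0)
    (ht : ∀ v, 1 ≤ t * inner ℝ c (f v) ^ 2) : G.lovaszNumber ≤ ENNReal.ofReal t := by
  classical
  -- The labels span at most |V| dimensions, so their span embeds isometrically into the prescribed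
  -- space.
  let U : Submodule ℝ E := Submodule.span ℝ (Set.range f)
  have hfin : FiniteDimensional ℝ U := FiniteDimensional.span_of_finite ℝ (Set.finite_range f)
  have hdim : Module.finrank ℝ U ≤ Fintype.card V := finrank_range_le_card f
  let g : V → U := fun v => ⟨f v, Submodule.subset_span ⟨v, rfl⟩⟩
  let b := stdOrthonormalBasis ℝ U
  obtain ⟨j⟩ : Nonempty (Fin (Module.finrank ℝ U) ↪ V) :=
    Function.Embedding.nonempty_of_card_le ((Fintype.card_fin _).trans_le hdim)
  let L₀ : U →ₗ[ℝ] EuclideanSpace ℝ V :=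
    b.toBasis.constr ℝ fun i => EuclideanSpace.basisFun V ℝ (j i)
  have hL₀ : Orthonormal ℝ (L₀ ∘ b.toBasis) := by
    have : L₀ ∘ b.toBasis = EuclideanSpace.basisFun V ℝ ∘ j := by
      funext i
      simp only [L₀, Function.comp_apply, Module.Basis.constr_basis]
    rw [this]
    exact (EuclideanSpace.basisFun V ℝ).orthonormal.comp j j.injective
  let L : U →ₗᵢ[ℝ] EuclideanSpace ℝ V :=
    L₀.isometryOfOrthonormal (v := b.toBasis) (by simp) hL₀
  -- Projecting the handle to the span keeps its inner products with the labels. Its norm does not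
  -- grow, so renormalizing can only increase their squares.
  let p : U := U.orthogonalProjectionOnto c
  have hp : ∀ v, inner ℝ p (g v) = inner ℝ c (f v) := fun v =>
    U.inner_orthogonalProjectionOnto_eq_of_mem_right (g v) c
  have hp1 : ‖p‖ ≤ 1 := hc ▸ U.norm_orthogonalProjectionOnto_apply_le c
  have hp0 : 0 < ‖p‖ := by
    rw [norm_pos_iff]
    intro e
    obtain ⟨v⟩ := ‹Nonempty V›
    have h := ht v
    rw [← hp v, e, inner_zero_left] at h
    norm_num at h
  have ht0 : 0 < t := by
    obtain ⟨v⟩ := ‹Nonempty V›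
    by_contra h
    nlinarith [ht v, mul_nonneg (neg_nonneg.2 (not_lt.1 h)) (sq_nonneg (inner ℝ c (f v)))]
  refine (iInf₂_le (‖p‖⁻¹ • L p) (fun v => L (g v))).trans
    ((iInf₂_le ?_ ⟨fun v => (L.norm_map _).trans (h1 v), fun u v huv hadj =>
      (L.inner_map_map _ _).trans (h0 u v huv hadj)⟩).trans (iSup_le fun v => ?_))
  · rw [norm_smul, norm_inv, norm_norm, L.norm_map, inv_mul_cancel₀ hp0.ne']
  · rw [inner_smul_left, L.inner_map_map, hp]
    have hq := ht v
    set q := inner ℝ c (f v)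
    rw [ENNReal.inv_le_iff_inv_le, ← ENNReal.ofReal_inv_of_pos ht0]
    refine ENNReal.ofReal_le_ofReal ?_
    have h3 : t⁻¹ ≤ q ^ 2 := by
      rw [inv_le_iff_one_le_mul₀ ht0]; linarith
    refine h3.trans ?_
    simp only [conj_trivial, mul_pow]
    have h4 : 1 ≤ ‖p‖⁻¹ ^ 2 := one_le_pow₀ ((one_le_inv₀ hp0).2 hp1)
    nlinarith [sq_nonneg q]

theorem IsLovaszRep.lovaszNumber_le [Nonempty V] {ι : Type*} [Fintype ι] {G : SimpleGraph V}
    {c : ι → ℝ} {f : V → ι → ℝ} {t : ℝ} (h : G.IsLovaszRep c f t) :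
    G.lovaszNumber ≤ ENNReal.ofReal t := by
  have hn : ∀ a : ι → ℝ, a ⬝ᵥ a = 1 → ‖WithLp.toLp 2 a‖ = 1 := fun a ha => by
    have := real_inner_self_eq_norm_sq (WithLp.toLp 2 a)
    rw [EuclideanSpace.inner_toLp_toLp, star_trivial, ha] at this
    exact (pow_eq_one_iff_of_nonneg (norm_nonneg _) two_ne_zero).1 this.symm
  refine G.lovaszNumber_le_of_inner (WithLp.toLp 2 c) (fun v => WithLp.toLp 2 (f v))
    (hn c h.handle) (fun v => hn _ (h.rep.1 v)) (fun u v huv hadj => ?_) fun v => ?_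
  · rw [EuclideanSpace.inner_toLp_toLp, star_trivial, dotProduct_comm, h.rep.2 u v huv hadj]
  · rw [EuclideanSpace.inner_toLp_toLp, star_trivial, dotProduct_comm]
    exact h.le_mul v

theorem indepNum_le_lovaszNumber [Nonempty V] (G : SimpleGraph V) :
    (G.indepNum : ℝ≥0∞) ≤ G.lovaszNumber := by
  rw [← ENNReal.ofReal_natCast]
  exact G.le_lovaszNumber fun c f t h => h.indepNum_le

end LovaszNumber

end SimpleGraph

namespace SimpleGraph

/-! ### Lovász representations of blow-ups. -/

section BlowUp

variable {V ι : Type*} [Fintype V] [Fintype ι]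

/-- A labeling of `G` whose values dominate the weights `p` up to the factor `t` spreads out to a
labeling of the blow-up of `G` along `p`. -/
theorem IsOrthogonalRep.exists_isLovaszRep_blowUp {G : SimpleGraph V} {p : V → ℕ} {c : ι → ℝ}
    {f : V → ι → ℝ} {t : ℝ} (hf : G.IsOrthogonalRep f) (hc : c ⬝ᵥ c = 1)
    (ht : ∀ v, (p v : ℝ) ≤ t * (c ⬝ᵥ f v) ^ 2) :
    ∃ (d : ι ⊕ (Σ v, Fin (p v)) → ℝ) (g : (Σ v, Fin (p v)) → ι ⊕ (Σ v, Fin (p v)) → ℝ),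
      (G.blowUp p).IsLovaszRep d g t := by
  classical
  let q : V → (Σ v, Fin (p v)) → ℝ := fun v y => if y.1 = v then (p v : ℝ)⁻¹ else 0
  have hq : ∀ v w, p v ≠ 0 → q v ⬝ᵥ q w = if v = w then (p v : ℝ)⁻¹ else 0 := by
    intro v w hv
    have hv' : (p v : ℝ) ≠ 0 := by exact_mod_cast hv
    simp only [q, dotProduct, Fintype.sum_sigma, ite_mul, zero_mul, mul_ite, mul_zero]
    rw [Finset.sum_eq_single v]
    · by_cases h : v = w
      · subst h
        simp [hv']
      · simp [h]
    · intro b _ hb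
      simp [hb]
    · simp
  -- Within a fibre the second components have Gram matrix identity minus 1/p, and the scaled `f`
  -- adds back 1/p, so copies become orthonormal. Across fibres only `f` contributes.
  let g : (Σ v, Fin (p v)) → ι ⊕ (Σ v, Fin (p v)) → ℝ := fun x =>
    Sum.elim ((√(p x.1 : ℝ))⁻¹ • f x.1) (Pi.single x 1 - q x.1)
  have hp : ∀ x : Σ v, Fin (p v), p x.1 ≠ 0 := fun x => (Fin.pos x.2).ne'
  have hsq : ∀ x : Σ v, Fin (p v), (√(p x.1 : ℝ))⁻¹ * (√(p x.1 : ℝ))⁻¹ = (p x.1 : ℝ)⁻¹ := fun x => by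
    rw [← mul_inv, Real.mul_self_sqrt (Nat.cast_nonneg _)]
  have hg : ∀ x y, g x ⬝ᵥ g y = (√(p x.1 : ℝ))⁻¹ * (√(p y.1 : ℝ))⁻¹ * (f x.1 ⬝ᵥ f y.1) +
      ((if x = y then 1 else 0) - if x.1 = y.1 then (p x.1 : ℝ)⁻¹ else 0) := by
    intro x y
    simp only [g, sumElim_dotProduct_sumElim, smul_dotProduct, dotProduct_smul, smul_eq_mul,
      sub_dotProduct, dotProduct_sub, single_dotProduct, dotProduct_single, Pi.sub_apply, one_mul, mul_one,
      hq _ _ (hp x)]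
    have h1 : (Pi.single x 1 : (Σ v, Fin (p v)) → ℝ) y = if x = y then 1 else 0 := by
      rw [Pi.single_apply]
      simp only [eq_comm]
    have h2 : q y.1 x = if x.1 = y.1 then (p x.1 : ℝ)⁻¹ else 0 := by
      simp only [q]; split_ifs with h
      · rw [h]
      · rfl
    have h3 : q x.1 y = if x.1 = y.1 then (p x.1 : ℝ)⁻¹ else 0 := by
      simp only [q, eq_comm]
    rw [h1, h2, h3]
    ring
  refine ⟨Sum.elim c 0, g, ⟨fun x => ?_, fun x y hxy hadj => ?_⟩, ?_, fun x => ?_⟩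
  · rw [hg, hf.1, hsq]
    simp
  · rw [hg, if_neg hxy]
    by_cases h : x.1 = y.1
    · rw [if_pos h, ← h, hf.1, hsq]
      ring
    · rw [if_neg h, hf.2 _ _ h hadj]
      ring
  · rw [sumElim_dotProduct_sumElim, hc]; simp
  · have hpx : (0 : ℝ) < p x.1 := by exact_mod_cast Nat.pos_of_ne_zero (hp x)
    have e : (Sum.elim c 0 : ι ⊕ (Σ v, Fin (p v)) → ℝ) ⬝ᵥ g x =
        (√(p x.1 : ℝ))⁻¹ * (c ⬝ᵥ f x.1) := by
      simp [g, sumElim_dotProduct_sumElim]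
    rw [e, mul_pow, inv_pow, Real.sq_sqrt hpx.le]
    calc (1 : ℝ) = (p x.1 : ℝ)⁻¹ * p x.1 := (inv_mul_cancel₀ hpx.ne').symm
      _ ≤ (p x.1 : ℝ)⁻¹ * (t * (c ⬝ᵥ f x.1) ^ 2) :=
        mul_le_mul_of_nonneg_left (ht x.1) (inv_nonneg.2 hpx.le)
      _ = _ := by ring

end BlowUp

end SimpleGraph

/-! ### Counting over triples by intersection size. -/

section Triples

/-- Two pairs of finite sets with the same cell sizes differ by a permutation. -/
theorem exists_perm_mem_iff {α : Type*} [Fintype α] [DecidableEq α] {v w v' w' : Finset α}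
    (hv : v.card = v'.card) (hw : w.card = w'.card) (hi : (v ∩ w).card = (v' ∩ w').card) :
    ∃ σ : Equiv.Perm α, ∀ i, (σ i ∈ v' ↔ i ∈ v) ∧ (σ i ∈ w' ↔ i ∈ w) := by
  -- The four cells cut out by the two sets have sizes determined by the three given cardinalities;
  -- bijections between corresponding cells glue to a permutation.
  have e : ∀ c : Bool × Bool, Nonempty ({i // (decide (i ∈ v), decide (i ∈ w)) = c} ≃
      {i // (decide (i ∈ v'), decide (i ∈ w')) = c}) := by
    intro c
    rw [← Fintype.card_eq, Fintype.card_subtype, Fintype.card_subtype]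
    have h1 : ∀ s t : Finset α, Finset.univ.filter (fun i => i ∈ s ∧ i ∈ t) = s ∩ t := by
      intro s t; ext; simp
    have h2 : ∀ s t : Finset α, Finset.univ.filter (fun i => i ∈ s ∧ i ∉ t) = s \ t := by
      intro s t; ext; simp
    have h3 : ∀ s t : Finset α, Finset.univ.filter (fun i => i ∉ s ∧ i ∈ t) = t \ s := by
      intro s t; ext; simp [and_comm]
    have h4 : ∀ s t : Finset α, Finset.univ.filter (fun i => i ∉ s ∧ i ∉ t) = (s ∪ t)ᶜ := by
      intro s t; ext; simp
    have a1 := Finset.card_sdiff_add_card_inter v w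
    have a2 := Finset.card_sdiff_add_card_inter v' w'
    have a3 := Finset.card_sdiff_add_card_inter w v
    have a4 := Finset.card_sdiff_add_card_inter w' v'
    have a5 := Finset.card_union_add_card_inter v w
    have a6 := Finset.card_union_add_card_inter v' w'
    rw [Finset.inter_comm w v] at a3
    rw [Finset.inter_comm w' v'] at a4
    rcases c with ⟨_ | _, _ | _⟩ <;>
      simp only [Prod.mk.injEq, decide_eq_true_eq, decide_eq_false_iff_not, h1, h2, h3, h4,
        Finset.card_compl] <;> omega
  refine ⟨Equiv.ofFiberEquiv fun c => (e c).some, fun i => ?_⟩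
  have h := Equiv.ofFiberEquiv_map (fun c => (e c).some) i
  simpa only [Prod.mk.injEq, decide_eq_decide] using h

/-- Reindexing by a permutation allows `v'` and `w'` to be concrete sets, and the sum over
`powersetCard` can then be evaluated. -/
theorem sum_triple_eq {M : Type*} [AddCommMonoid M] (F : ℕ → ℕ → M)
    {v w v' w' : Finset (Fin 12)} (hv : v.card = v'.card) (hw : w.card = w'.card)
    (hi : (v ∩ w).card = (v' ∩ w').card) :
    ∑ z : Triple, F (v ∩ z.1).card (w ∩ z.1).card =
      ∑ z ∈ Finset.powersetCard 3 Finset.univ, F (v' ∩ z).card (w' ∩ z).card := by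
  obtain ⟨σ, hσ⟩ := exists_perm_mem_iff hv hw hi
  have hmap : ∀ (s s' z : Finset (Fin 12)), (∀ i, σ i ∈ s' ↔ i ∈ s) →
      (s' ∩ z.map σ.toEmbedding).card = (s ∩ z).card := by
    intro s s' z h
    have : s' = s.map σ.toEmbedding := by
      ext i
      rw [Finset.mem_map_equiv, ← h, σ.apply_symm_apply]
    rw [this, ← Finset.map_inter, Finset.card_map]
  refine Finset.sum_bij' (fun z _ => z.1.map σ.toEmbedding)
    (fun z hz => ⟨z.map σ.symm.toEmbedding, by
      rw [Finset.card_map]; exact (Finset.mem_powersetCard.1 hz).2⟩) ?_ ?_ ?_ ?_ ?_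
  · intro z _
    simp [Finset.mem_powersetCard, z.2]
  · intro z _
    exact Finset.mem_univ _
  · intro z _
    ext i
    simp
  · intro z _
    ext i
    simp
  · intro z _
    rw [hmap v v' z.1 fun i => (hσ i).1, hmap w w' z.1 fun i => (hσ i).2]

theorem triple_inter_card_eq_three_iff {v w : Triple} : (v.1 ∩ w.1).card = 3 ↔ v = w := by
  constructor
  · intro h
    have h1 : v.1 ∩ w.1 = v.1 := Finset.eq_of_subset_of_card_le Finset.inter_subset_left (by
      rw [h, v.2])
    have h2 : v.1 ∩ w.1 = w.1 := Finset.eq_of_subset_of_card_le Finset.inter_subset_right (by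
      rw [h, w.2])
    exact Subtype.ext (h1.symm.trans h2)
  · rintro rfl
    rw [Finset.inter_self, v.2]

theorem triple_inter_card_le (v w : Triple) : (v.1 ∩ w.1).card ≤ 3 :=
  (Finset.card_le_card Finset.inter_subset_left).trans v.2.le

/-- A sum over all triples depends only on the size of the intersection. -/
theorem forall_sum_triple {M : Type*} [AddCommMonoid M] (F : ℕ → ℕ → M) (Q : ℕ → M)
    (h3 : ∑ z ∈ Finset.powersetCard 3 (Finset.univ : Finset (Fin 12)),
      F (({0, 1, 2} ∩ z).card) (({0, 1, 2} ∩ z).card) = Q 3)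
    (h2 : ∑ z ∈ Finset.powersetCard 3 (Finset.univ : Finset (Fin 12)),
      F (({0, 1, 2} ∩ z).card) (({0, 1, 3} ∩ z).card) = Q 2)
    (h1 : ∑ z ∈ Finset.powersetCard 3 (Finset.univ : Finset (Fin 12)),
      F (({0, 1, 2} ∩ z).card) (({0, 3, 4} ∩ z).card) = Q 1)
    (h0 : ∑ z ∈ Finset.powersetCard 3 (Finset.univ : Finset (Fin 12)),
      F (({0, 1, 2} ∩ z).card) (({3, 4, 5} ∩ z).card) = Q 0) (v w : Triple) :
    ∑ z : Triple, F (v.1 ∩ z.1).card (w.1 ∩ z.1).card = Q (v.1 ∩ w.1).card := by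
  have hle := triple_inter_card_le v w
  generalize hk : (v.1 ∩ w.1).card = k at hle
  interval_cases k
  · rw [← h0]; exact sum_triple_eq F (v.2.trans rfl) (w.2.trans rfl) (hk.trans rfl)
  · rw [← h1]; exact sum_triple_eq F (v.2.trans rfl) (w.2.trans rfl) (hk.trans rfl)
  · rw [← h2]; exact sum_triple_eq F (v.2.trans rfl) (w.2.trans rfl) (hk.trans rfl)
  · rw [← h3]; exact sum_triple_eq F (v.2.trans rfl) (w.2.trans rfl) (hk.trans rfl)

/-- The entries of `90 √13` times the square root of `1 + A / 13`, where `A` is the adjacency matrix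
of `tripleGraph`. -/
def sqrtEntry (k : ℕ) : ℤ :=
  if k = 3 then 279 else if k = 2 then -11 else if k = 1 then 14 else -6

/-- The entries of `440` times the projection to the eigenspace of `tripleGraph` for the
eigenvalue `-13`. -/
def projEntry (k : ℕ) : ℤ :=
  if k = 3 then 108 else if k = 2 then 20 else if k = 1 then -13 else 9

/-- The square of the matrix of `sqrtEntry` is 90² · 13 = 105300 times 1 + A/13. -/
theorem sum_sqrtEntry_mul (v w : Triple) :
    ∑ z : Triple, sqrtEntry (v.1 ∩ z.1).card * sqrtEntry (w.1 ∩ z.1).card =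
      if (v.1 ∩ w.1).card = 3 then 105300 else if (v.1 ∩ w.1).card = 1 then 8100 else 0 :=
  forall_sum_triple (fun a b => sqrtEntry a * sqrtEntry b)
    (fun k => if k = 3 then 105300 else if k = 1 then 8100 else 0)
    (by decide +kernel) (by decide +kernel) (by decide +kernel) (by decide +kernel) v w

/-- Idempotency of the projection, cleared of denominators. -/
theorem sum_projEntry_mul (v w : Triple) :
    ∑ z : Triple, projEntry (v.1 ∩ z.1).card * projEntry (w.1 ∩ z.1).card =
      440 * projEntry (v.1 ∩ w.1).card :=
  forall_sum_triple (fun a b => projEntry a * projEntry b) (fun k => 440 * projEntry k)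
    (by decide +kernel) (by decide +kernel) (by decide +kernel) (by decide +kernel) v w

theorem sum_sqrtEntry (v : Triple) : ∑ z : Triple, sqrtEntry (v.1 ∩ z.1).card = 990 :=
  forall_sum_triple (fun a _ => sqrtEntry a) (fun _ => 990)
    (by decide +kernel) (by decide +kernel) (by decide +kernel) (by decide +kernel) v v

theorem card_triple : Fintype.card Triple = 220 := by
  rw [Fintype.card_finset_len]
  rfl

theorem tripleGraph_degree (v : Triple) : tripleGraph.degree v = 108 := by
  rw [← SimpleGraph.card_neighborFinset_eq_degree, SimpleGraph.neighborFinset_eq_filter,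
    Finset.card_filter]
  exact forall_sum_triple (fun a _ => if a = 1 then 1 else 0) (fun _ => 108)
    (by decide +kernel) (by decide +kernel) (by decide +kernel) (by decide +kernel) v v

theorem card_tripleGraph_edgeSet : Nat.card tripleGraph.edgeSet = 11880 := by
  have h := tripleGraph.sum_degrees_eq_twice_card_edges
  simp only [tripleGraph_degree, Finset.sum_const, Finset.card_univ, card_triple,
    smul_eq_mul] at h
  rw [Nat.card_eq_fintype_card, ← SimpleGraph.edgeFinset_card]
  omega

theorem card_triplePairBlowUp : Nat.card (Σ v, Fin (triplePairWeight v)) = 1131460 := by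
  have h := card_tripleGraph_edgeSet
  rw [Nat.card_eq_fintype_card] at h
  simp only [Nat.card_eq_fintype_card, Fintype.card_sigma, Fintype.card_fin, Fintype.sum_sum_type,
    triplePairWeight, Sum.elim_inl, Sum.elim_inr, Finset.sum_const, Finset.card_univ, card_triple,
    h, smul_eq_mul]

end Triples

/-! ### The explicit representations of the two graphs. -/

section Labelings

/-- The dot product is the parity of the intersection: odd for size 3, even for the non-adjacent
sizes 0 and 2. -/
theorem tripleGraph_isOrthogonalRep_zmod :
    tripleGraph.IsOrthogonalRep fun v (i : Fin 12) => if i ∈ v.1 then (1 : ZMod 2) else 0 := by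
  have h : ∀ v w : Triple, (fun i : Fin 12 => if i ∈ v.1 then (1 : ZMod 2) else 0) ⬝ᵥ
      (fun i => if i ∈ w.1 then 1 else 0) = ((v.1 ∩ w.1).card : ZMod 2) := by
    intro v w
    have e : v.1 ∩ w.1 = Finset.univ.filter fun i => i ∈ v.1 ∧ i ∈ w.1 := by ext; simp
    simp only [dotProduct, mul_ite, mul_one, mul_zero, e, Finset.card_filter, Nat.cast_sum,
      Nat.cast_ite, Nat.cast_one, Nat.cast_zero]
    exact Finset.sum_congr rfl fun i _ => by split_ifs <;> tauto
  refine ⟨fun v => ?_, fun v w hvw hadj => ?_⟩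
  · rw [h, Finset.inter_self, v.2]; rfl
  · rw [h]
    have h1 := triple_inter_card_le v w
    have h2 : (v.1 ∩ w.1).card ≠ 3 := fun e => hvw (triple_inter_card_eq_three_iff.1 e)
    have h3 : (v.1 ∩ w.1).card ≠ 1 := hadj
    generalize (v.1 ∩ w.1).card = k at h1 h2 h3
    interval_cases k <;> first | rfl | omega

/-- The labels are the rows of the square root of 1 + A/13, and the handle is the uniform unit
vector. Row sums 11/√13 give the squared inner product 121/(13 · 220) = 11/260. -/
theorem tripleGraph_isLovaszRep :
    tripleGraph.IsLovaszRep (fun _ : Triple => (√220)⁻¹)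
      (fun v z => (90 * √13)⁻¹ * (sqrtEntry (v.1 ∩ z.1).card : ℝ)) (260 / 11) := by
  have h220 : √(220 : ℝ) ^ 2 = 220 := Real.sq_sqrt (by norm_num)
  have h13 : √(13 : ℝ) ^ 2 = 13 := Real.sq_sqrt (by norm_num)
  have hdot : ∀ v w : Triple,
      (fun z : Triple => (90 * √13)⁻¹ * (sqrtEntry (v.1 ∩ z.1).card : ℝ)) ⬝ᵥ
        (fun z : Triple => (90 * √13)⁻¹ * (sqrtEntry (w.1 ∩ z.1).card : ℝ)) =
      (((if (v.1 ∩ w.1).card = 3 then 105300 else if (v.1 ∩ w.1).card = 1 then 8100 else 0 : ℤ)) : ℝ)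
        / 105300 := by
    intro v w
    rw [← sum_sqrtEntry_mul, Int.cast_sum, Finset.sum_div]
    refine Finset.sum_congr rfl fun z _ => ?_
    have : ((90 * √13)⁻¹ * (90 * √13)⁻¹ : ℝ) = 1 / 105300 := by
      rw [← mul_inv, ← sq, mul_pow, h13]; norm_num
    rw [mul_mul_mul_comm, this, Int.cast_mul]
    ring
  refine ⟨⟨fun v => ?_, fun v w hvw hadj => ?_⟩, ?_, fun v => ?_⟩
  · rw [hdot, if_pos (triple_inter_card_eq_three_iff.2 rfl)]; norm_num
  · rw [hdot, if_neg fun e => hvw (triple_inter_card_eq_three_iff.1 e), if_neg (show ¬ (v.1 ∩ w.1).card = 1 from hadj)]; norm_num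
  · simp only [dotProduct, Finset.sum_const, Finset.card_univ, card_triple, nsmul_eq_mul, ← sq,
      inv_pow, h220]
    norm_num
  · have e : (fun _ : Triple => (√220 : ℝ)⁻¹) ⬝ᵥ
        (fun z : Triple => (90 * √13)⁻¹ * (sqrtEntry (v.1 ∩ z.1).card : ℝ)) =
        (√220)⁻¹ * (90 * √13)⁻¹ * 990 := by
      simp only [dotProduct, ← mul_assoc, ← Finset.mul_sum, ← Int.cast_sum, sum_sqrtEntry]
      norm_num
    rw [e, mul_pow, mul_pow, inv_pow, inv_pow, mul_pow, h220, h13]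
    norm_num

/-- The vector of a triple in a labeling of the complement of `tripleGraph`. -/
noncomputable def tripleVec (v : Triple) : Unit ⊕ Triple → ℝ :=
  Sum.elim (fun _ => √13 / 11) fun z => (√(440 * 121))⁻¹ * (projEntry (v.1 ∩ z.1).card : ℝ)

/-- The handle of the labeling by `tripleVec`. -/
def tripleHandle : Unit ⊕ Triple → ℝ := Sum.elim 1 0

theorem tripleHandle_dotProduct_self : tripleHandle ⬝ᵥ tripleHandle = 1 := by
  rw [tripleHandle, sumElim_dotProduct_sumElim]
  simp

theorem tripleHandle_dotProduct_tripleVec (v : Triple) :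
    tripleHandle ⬝ᵥ tripleVec v = √13 / 11 := by
  rw [tripleHandle, tripleVec, sumElim_dotProduct_sumElim]
  simp [dotProduct]

/-- The constant 13 cancels the entry -13 at intersection size 1, and 13 + 108 = 121 makes the
vectors unit. -/
theorem tripleVec_dotProduct (v w : Triple) :
    tripleVec v ⬝ᵥ tripleVec w = (13 + projEntry (v.1 ∩ w.1).card) / 121 := by
  have h13 : √(13 : ℝ) * √13 = 13 := Real.mul_self_sqrt (by norm_num)
  have h1 : (√(440 * 121 : ℝ))⁻¹ * (√(440 * 121))⁻¹ = 1 / (440 * 121) := by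
    rw [← mul_inv, Real.mul_self_sqrt (by norm_num), one_div]
  have h2 : (fun z : Triple => (√(440 * 121))⁻¹ * (projEntry (v.1 ∩ z.1).card : ℝ)) ⬝ᵥ
      (fun z : Triple => (√(440 * 121))⁻¹ * (projEntry (w.1 ∩ z.1).card : ℝ)) =
      projEntry (v.1 ∩ w.1).card / 121 := by
    have := sum_projEntry_mul v w
    have h3 : ∑ z : Triple, (projEntry (v.1 ∩ z.1).card : ℝ) * projEntry (w.1 ∩ z.1).card =
        440 * projEntry (v.1 ∩ w.1).card := by exact_mod_cast this
    simp only [dotProduct, mul_mul_mul_comm _ (projEntry _ : ℝ), h1, ← Finset.mul_sum, h3]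
    ring
  rw [tripleVec, tripleVec, sumElim_dotProduct_sumElim, h2]
  simp only [dotProduct, Finset.univ_unique, Finset.sum_const, Finset.card_singleton, one_smul]
  linear_combination h13 / 121

theorem tripleVec_dotProduct_self (v : Triple) : tripleVec v ⬝ᵥ tripleVec v = 1 := by
  rw [tripleVec_dotProduct, triple_inter_card_eq_three_iff.2 rfl]
  norm_num [projEntry]

theorem tripleVec_dotProduct_eq_zero {v w : Triple} (h : tripleGraph.Adj v w) :
    tripleVec v ⬝ᵥ tripleVec w = 0 := by
  rw [tripleVec_dotProduct, show (v.1 ∩ w.1).card = 1 from h]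
  norm_num [projEntry]

/-- The normalized projection of the handle to the complement of the vectors of an edge. -/
theorem exists_pairVec (e : tripleGraph.edgeSet) : ∃ x : Unit ⊕ Triple → ℝ, x ⬝ᵥ x = 1 ∧
    (∀ v ∈ e.1, tripleVec v ⬝ᵥ x = 0) ∧ (tripleHandle ⬝ᵥ x) ^ 2 = 95 / 121 := by
  obtain ⟨e, he⟩ := e
  induction e using Sym2.ind with
  | _ v w =>
  have hvw : tripleGraph.Adj v w := he
  have h13 : √(13 : ℝ) ^ 2 = 13 := Real.sq_sqrt (by norm_num)
  have h95 : √(95 : ℝ) ^ 2 = 95 := Real.sq_sqrt (by norm_num)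
  have h95' : (√(95 : ℝ))⁻¹ ^ 2 = 1 / 95 := by rw [inv_pow, h95, one_div]
  have hc := tripleHandle_dotProduct_self
  have hcv := tripleHandle_dotProduct_tripleVec
  have hvc : ∀ u, tripleVec u ⬝ᵥ tripleHandle = √13 / 11 := fun u => by
    rw [dotProduct_comm, hcv]
  -- The two labels are orthonormal, so the projected handle has squared norm 1 - 2 · 13/121 =
  -- 95/121. This fixes the factor 11/√95 and is also the squared inner product with the handle.
  refine ⟨(11 * (√95)⁻¹) • (tripleHandle - (√13 / 11) • (tripleVec v + tripleVec w)), ?_, ?_, ?_⟩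
  · simp only [smul_dotProduct, dotProduct_smul, sub_dotProduct, dotProduct_sub, add_dotProduct,
      dotProduct_add, smul_eq_mul, hc, hcv, hvc, tripleVec_dotProduct_self,
      tripleVec_dotProduct_eq_zero hvw, tripleVec_dotProduct_eq_zero hvw.symm]
    linear_combination (95 : ℝ) * h95' - 2 * (√95)⁻¹ ^ 2 * h13
  · intro u hu
    have hu : u = v ∨ u = w := by simpa using hu
    rcases hu with rfl | rfl <;>
    · simp only [dotProduct_smul, dotProduct_sub, dotProduct_add, smul_eq_mul, hvc,
        tripleVec_dotProduct_self,
        tripleVec_dotProduct_eq_zero hvw, tripleVec_dotProduct_eq_zero hvw.symm]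
      ring
  · simp only [dotProduct_smul, dotProduct_sub, dotProduct_add, smul_eq_mul, hc, hcv]
    have e1 : 11 * (√95)⁻¹ * (1 - √13 / 11 * (√13 / 11 + √13 / 11)) = 95 / 11 * (√95)⁻¹ := by
      linear_combination (-2 / 11 : ℝ) * (√95)⁻¹ * h13
    rw [e1, mul_pow, h95']
    norm_num

theorem exists_isLovaszRep_triplePairBlowUp :
    ∃ (d : (Unit ⊕ Triple) ⊕ (Σ v, Fin (triplePairWeight v)) → ℝ)
      (g : (Σ v, Fin (triplePairWeight v)) → (Unit ⊕ Triple) ⊕ (Σ v, Fin (triplePairWeight v)) → ℝ),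
      triplePairBlowUp.IsLovaszRep d g 121 := by
  choose x hx1 hx0 hxc using exists_pairVec
  have h13 : √(13 : ℝ) ^ 2 = 13 := Real.sq_sqrt (by norm_num)
  have hrep : triplePairGraph.IsOrthogonalRep (Sum.elim tripleVec x) := by
    refine ⟨?_, ?_⟩
    · rintro (v | e)
      · exact tripleVec_dotProduct_self v
      · exact hx1 e
    · rintro (v | e) (w | f) hne hadj
      · refine tripleVec_dotProduct_eq_zero ?_
        have h1 := triple_inter_card_le v w
        have h2 : (v.1 ∩ w.1).card ≠ 3 := fun e =>
          hne (congrArg Sum.inl (triple_inter_card_eq_three_iff.1 e))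
        have h3 : ¬ ((v.1 ∩ w.1).card = 0 ∨ (v.1 ∩ w.1).card = 2) := hadj
        change (v.1 ∩ w.1).card = 1
        omega
      · exact hx0 f v (not_not.1 hadj)
      · exact (dotProduct_comm _ _).trans (hx0 e w (not_not.1 hadj))
      · exact absurd (fun h => hne (congrArg Sum.inr h)) hadj
  refine hrep.exists_isLovaszRep_blowUp tripleHandle_dotProduct_self ?_
  rintro (v | e)
  · simp only [Sum.elim_inl, tripleHandle_dotProduct_tripleVec, div_pow, h13, triplePairWeight]
    norm_num
  · simp only [Sum.elim_inr, hxc, triplePairWeight]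
    norm_num

end Labelings

/-! ### Independent sets that attain the bounds, and absence of isolated vertices. -/

section IndependentSets

theorem twelve_le_indepNum_tripleGraph : 12 ≤ tripleGraph.indepNum := by
  -- Split the 12 points into three blocks of four and take each block minus one point:
  -- intersections have size 2 within a block and 0 across blocks.
  let f : Fin 12 → Triple := fun i =>
    ⟨(Finset.univ.filter fun j : Fin 12 => j.1 / 4 = i.1 / 4).erase i, by
      revert i; decide +kernel⟩
  have hf : Function.Injective f := by decide +kernel
  have h := SimpleGraph.card_le_indepNum_of_embedding (H := tripleGraph) ⟨f, hf⟩ (by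
    change ∀ u v : Fin 12, ¬ tripleGraph.Adj (f u) (f v)
    decide +kernel)
  rwa [Fintype.card_fin] at h

theorem exists_tripleGraph_adj (v : Triple) : ∃ w, tripleGraph.Adj v w := by
  rw [← SimpleGraph.degree_pos_iff_exists_adj, tripleGraph_degree]
  norm_num

instance nonempty_triple : Nonempty Triple := ⟨⟨{0, 1, 2}, rfl⟩⟩

theorem sigma_fin_injective {α : Type*} {p : α → ℕ} (a : α) (i j : Fin (p a))
    (h : (⟨a, i⟩ : Σ a, Fin (p a)) = ⟨a, j⟩) : i = j :=
  eq_of_heq (Sigma.mk.inj h).2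

theorem le_indepNum_triplePairBlowUp : 121 ≤ triplePairBlowUp.indepNum := by
  obtain ⟨v⟩ := nonempty_triple
  obtain ⟨w, hvw⟩ := exists_tripleGraph_adj v
  have h1 : (v.1 ∩ w.1).card = 1 := hvw
  have h1' : (w.1 ∩ v.1).card = 1 := hvw.symm
  let e : tripleGraph.edgeSet := ⟨s(v, w), hvw⟩
  -- All copies of two adjacent triples and of the edge joining them: 13 + 13 + 95.
  let f : (Fin 13 ⊕ Fin 13) ⊕ Fin 95 → Σ v, Fin (triplePairWeight v) :=
    Sum.elim (Sum.elim (fun i => ⟨.inl v, i⟩) (fun i => ⟨.inl w, i⟩)) (fun i => ⟨.inr e, i⟩)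
  have hf : Function.Injective f := by
    have hne : (Sum.inl v : Triple ⊕ tripleGraph.edgeSet) ≠ .inl w := fun h =>
      hvw.ne (Sum.inl.inj h)
    rintro ((i | i) | i) ((j | j) | j) h
    · exact congrArg (fun i => Sum.inl (Sum.inl i)) (sigma_fin_injective (p := triplePairWeight) (.inl v) i j h)
    · exact absurd (congrArg Sigma.fst h) hne
    · exact absurd (congrArg Sigma.fst h) Sum.inl_ne_inr
    · exact absurd (congrArg Sigma.fst h) hne.symm
    · exact congrArg (fun i => Sum.inl (Sum.inr i)) (sigma_fin_injective (p := triplePairWeight) (.inl w) i j h)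
    · exact absurd (congrArg Sigma.fst h) Sum.inl_ne_inr
    · exact absurd (congrArg Sigma.fst h) Sum.inr_ne_inl
    · exact absurd (congrArg Sigma.fst h) Sum.inr_ne_inl
    · exact congrArg Sum.inr (sigma_fin_injective (p := triplePairWeight) (.inr e) i j h)
  have hself : ∀ u, ¬ triplePairGraph.Adj u u := fun u => triplePairGraph.irrefl
  have hvw' : ¬ triplePairGraph.Adj (.inl v) (.inl w) := fun h => by
    have h : (v.1 ∩ w.1).card = 0 ∨ (v.1 ∩ w.1).card = 2 := h
    omega
  have hve : ¬ triplePairGraph.Adj (.inl v) (.inr e) := fun h => h (Sym2.mem_mk_left v w)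
  have hwe : ¬ triplePairGraph.Adj (.inl w) (.inr e) := fun h => h (Sym2.mem_mk_right v w)
  have h := SimpleGraph.card_le_indepNum_of_embedding (H := triplePairBlowUp) ⟨f, hf⟩ (by
    rintro ((i | i) | i) ((j | j) | j)
    · exact hself (.inl v)
    · exact hvw'
    · exact hve
    · exact fun h => hvw' h.symm
    · exact hself (.inl w)
    · exact hwe
    · exact fun h => hve h.symm
    · exact fun h => hwe h.symm
    · exact hself (.inr e))
  simpa using h

theorem le_indepNum_strongProduct :
    2860 ≤ (tripleGraph.strongProduct triplePairBlowUp).indepNum := by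
  -- The diagonal: intersection size 1 in the first factor excludes sizes 0 and 2 in the second.
  let f : Triple × Fin 13 → Triple × Σ v, Fin (triplePairWeight v) :=
    fun x => (x.1, ⟨.inl x.1, x.2⟩)
  have hf : Function.Injective f := by
    rintro ⟨v, i⟩ ⟨w, j⟩ h
    obtain ⟨rfl, h2⟩ := Prod.mk.inj h
    exact congrArg (Prod.mk v) (sigma_fin_injective (p := triplePairWeight) (.inl v) i j h2)
  have h := SimpleGraph.card_le_indepNum_of_embedding
    (H := tripleGraph.strongProduct triplePairBlowUp) ⟨f, hf⟩ (by
      rintro ⟨v, i⟩ ⟨w, j⟩ hadj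
      have h : ∀ v w : Triple, triplePairGraph.Adj (.inl v) (.inl w) ↔
        ((v.1 ∩ w.1).card = 0 ∨ (v.1 ∩ w.1).card = 2) := fun _ _ => Iff.rfl
      rcases hadj with ⟨h1, h2⟩ | ⟨h1, h2⟩ | ⟨h1, h2⟩
      · have h1 : (v.1 ∩ w.1).card = 1 := h1
        have h2 := (h v w).1 h2
        omega
      · have h3 : v = w := Sum.inl.inj (congrArg Sigma.fst h2)
        exact h1.ne h3
      · have h1 : v = w := h1
        subst h1
        exact triplePairGraph.irrefl (v := .inl v) h2)
  rw [Fintype.card_prod, card_triple, Fintype.card_fin] at h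
  exact h

theorem not_isIsolated_triplePairBlowUp (x : Σ v, Fin (triplePairWeight v)) :
    ¬ triplePairBlowUp.IsIsolated x := by
  intro h
  obtain ⟨v | e, i⟩ := x
  · obtain ⟨t, ht, hc⟩ := Finset.exists_subset_card_eq (s := (v.1)ᶜ) (n := 3) (by
      rw [Finset.card_compl, v.2, Fintype.card_fin]; norm_num)
    refine h ⟨.inl ⟨t, hc⟩, (0 : Fin 13)⟩ (Or.inl ?_)
    rw [Finset.card_eq_zero, ← Finset.disjoint_iff_inter_eq_empty]
    exact Finset.disjoint_left.2 fun a ha hb => Finset.mem_compl.1 (ht hb) ha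
  · obtain ⟨e, he⟩ := e
    have : ∃ u : Triple, u ∉ e := by
      induction e using Sym2.ind with
      | _ v w =>
      have hlt : ({v, w} : Finset Triple).card < Fintype.card Triple := by
        rw [card_triple]
        exact Finset.card_le_two.trans_lt (by norm_num)
      obtain ⟨u, -, hu⟩ := Finset.exists_mem_notMem_of_card_lt_card
        (hlt.trans_eq Finset.card_univ.symm)
      exact ⟨u, by simpa using hu⟩
    obtain ⟨u, hu⟩ := this
    exact h ⟨.inl u, (0 : Fin 13)⟩ hu

end IndependentSets

theorem mainTheorem1 :
    (∃ (V₁ V₂ : Type) (_ : Fintype V₁) (_ : Fintype V₂)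
        (G₁ : SimpleGraph V₁) (G₂ : SimpleGraph V₂),
      (∀ v, ¬ G₁.IsIsolated v) ∧ (∀ v, ¬ G₂.IsIsolated v) ∧
      G₁.IsSingleShot ∧ G₂.IsSingleShot ∧
      (G₂.indepNum : ℝ≥0∞) = G₂.lovaszNumber ∧
      (G₁.strongProduct G₂).shannonCapacity > G₁.shannonCapacity * G₂.shannonCapacity ∧
      (G₁ ⊕g G₂).shannonCapacity > G₁.shannonCapacity + G₂.shannonCapacity) ∧
    -- the explicit instance
    (∀ v, ¬ tripleGraph.IsIsolated v) ∧ (∀ v, ¬ triplePairBlowUp.IsIsolated v) ∧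
    Nat.card Triple = 220 ∧
    Nat.card (Σ v, Fin (triplePairWeight v)) = 1131460 ∧
    tripleGraph.indepNum = 12 ∧ tripleGraph.shannonCapacity = 12 ∧
    tripleGraph.lovaszNumber = 260 / 11 ∧
    triplePairBlowUp.indepNum = 121 ∧ triplePairBlowUp.shannonCapacity = 121 ∧
    triplePairBlowUp.lovaszNumber = 121 ∧
    2860 ≤ (tripleGraph.strongProduct triplePairBlowUp).indepNum ∧
    (tripleGraph.strongProduct triplePairBlowUp).shannonCapacity ≥
      (tripleGraph.strongProduct triplePairBlowUp).indepNum ∧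
    (tripleGraph.strongProduct triplePairBlowUp).shannonCapacity >
      tripleGraph.shannonCapacity * triplePairBlowUp.shannonCapacity ∧
    (tripleGraph ⊕g triplePairBlowUp).shannonCapacity >
      tripleGraph.shannonCapacity + triplePairBlowUp.shannonCapacity := by
  have hne : Nonempty (Σ v, Fin (triplePairWeight v)) :=
    ⟨⟨.inl (Classical.arbitrary Triple), (0 : Fin 13)⟩⟩
  have iso₁ : ∀ v, ¬ tripleGraph.IsIsolated v := fun v h =>
    (exists_tripleGraph_adj v).elim fun w hw => h w hw
  have cap₁ : tripleGraph.shannonCapacity ≤ 12 := by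
    simpa using tripleGraph_isOrthogonalRep_zmod.shannonCapacity_le_card
  have ind₁ : tripleGraph.indepNum = 12 := by
    refine le_antisymm ?_ twelve_le_indepNum_tripleGraph
    exact_mod_cast tripleGraph.indepNum_le_shannonCapacity.trans cap₁
  have cap₁' : tripleGraph.shannonCapacity = 12 :=
    le_antisymm cap₁ (by simpa [ind₁] using tripleGraph.indepNum_le_shannonCapacity)
  obtain ⟨d, g, hg⟩ := exists_isLovaszRep_triplePairBlowUp
  have cap₂ : triplePairBlowUp.shannonCapacity ≤ 121 := hg.shannonCapacity_le
  have ind₂ : triplePairBlowUp.indepNum = 121 := by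
    refine le_antisymm ?_ le_indepNum_triplePairBlowUp
    exact_mod_cast triplePairBlowUp.indepNum_le_shannonCapacity.trans cap₂
  have cap₂' : triplePairBlowUp.shannonCapacity = 121 :=
    le_antisymm cap₂ (by simpa [ind₂] using triplePairBlowUp.indepNum_le_shannonCapacity)
  have lov₂ : triplePairBlowUp.lovaszNumber = 121 := by
    refine le_antisymm ?_ ?_
    · simpa using hg.lovaszNumber_le
    · simpa [ind₂] using triplePairBlowUp.indepNum_le_lovaszNumber
  have hprod := le_indepNum_strongProduct
  have hprod' : (2860 : ℝ) ≤ (tripleGraph.strongProduct triplePairBlowUp).indepNum := by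
    exact_mod_cast hprod
  have lov₁ : tripleGraph.lovaszNumber = 260 / 11 := by
    have e : ENNReal.ofReal (260 / 11) = 260 / 11 := by
      rw [ENNReal.ofReal_div_of_pos (by norm_num)]
      norm_num
    rw [← e]
    refine le_antisymm tripleGraph_isLovaszRep.lovaszNumber_le
      (tripleGraph.le_lovaszNumber fun c f t hf => ?_)
    -- The lower bound comes from the product: its 2860 independent points force 2860 ≤ t · 121.
    have h := hprod'.trans (hf.strongProduct hg).indepNum_le
    linarith
  have hcap := (tripleGraph.strongProduct triplePairBlowUp).indepNum_le_shannonCapacity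
  have hmul : (tripleGraph.strongProduct triplePairBlowUp).shannonCapacity >
      tripleGraph.shannonCapacity * triplePairBlowUp.shannonCapacity := by
    rw [cap₁', cap₂']
    linarith
  have hadd : (tripleGraph ⊕g triplePairBlowUp).shannonCapacity >
      tripleGraph.shannonCapacity + triplePairBlowUp.shannonCapacity := by
    rw [cap₁', cap₂']
    -- Here 12² + 2 · 2860 + 121² = 20505 exceeds (12 + 121)² = 17689.
    have h1 := tripleGraph.indepNum_sum_strongPower_two triplePairBlowUp
    have h2 := (tripleGraph ⊕g triplePairBlowUp).indepNum_strongPower_le_pow two_ne_zero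
    rw [ind₁, ind₂] at h1
    have h3 : (12 ^ 2 + 2 * 2860 + 121 ^ 2 : ℝ) ≤
        ((tripleGraph ⊕g triplePairBlowUp).strongPower 2).indepNum := by
      exact_mod_cast le_trans (by gcongr) h1
    nlinarith [(tripleGraph ⊕g triplePairBlowUp).shannonCapacity_nonneg]
  have s₁ : tripleGraph.IsSingleShot := by
    rw [SimpleGraph.IsSingleShot, ind₁, cap₁']; norm_num
  have s₂ : triplePairBlowUp.IsSingleShot := by
    rw [SimpleGraph.IsSingleShot, ind₂, cap₂']; norm_num
  refine ⟨⟨Triple, Σ v, Fin (triplePairWeight v), inferInstance, inferInstance, tripleGraph,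
    triplePairBlowUp, iso₁, not_isIsolated_triplePairBlowUp, s₁, s₂, ?_, hmul, hadd⟩, iso₁,
    not_isIsolated_triplePairBlowUp, ?_, card_triplePairBlowUp, ind₁, cap₁', lov₁, ind₂, cap₂',
    lov₂, hprod, hcap, hmul, hadd⟩
  · rw [ind₂, lov₂]; norm_num
  · rw [Nat.card_eq_fintype_card, card_triple]
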